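/- For an integer $n>0$ let $I_n=\{(t,t/n):t\in[0,1]\}\subset\mathbb R^2$. Let $X=\bigcup_{n>0}I_n$ with the subspace topology of the plane (the connected metric fan), and let $Y$ be the same set $\bigcup_{n>0}I_n$ with the strongest topology that induces the Euclidean topology on each arc $I_n$ (the connected Fréchet–Urysohn fan). For topological spaces $Z$ and $T$ let $C_k(Z,T)$ be the space of continuous maps $Z\to T$ with the compact-open topology. The space $Z$ is called $T$-Ascoli if for every compact set $\mathcal K\subset C_k(Z,T)$ the evaluation map $\mathcal K\times Z\to T$, $(f,z)\mapsto f(z)$, is continuous; $Z$ is Ascoli if it is $\mathbb R$-Ascoli, and $2$-Ascoli if it is $T$-Ascoli for the discrete two-point space $T=\{0,1\}$. An $\aleph_0$-space is a regular $T_1$-space $Z$ that has a countable family $\mathcal N$ of subsets such that for every open $U\subset Z$ and compact $K\subset U$ there is a finite $\mathcal F\subset\mathcal N$ with $K\subset\bigcup\mathcal F\subset U$. A regular $T_1$-space $Z$ is stratifiable if one can assign to every $n\in\mathbb N$ and every closed set $F\subset Z$ an open set $G(n,F)\supset F$ such that $F=\bigcap_{n}\overline{G(n,F)}$, and $G(n,F)\subset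 G(n,F')$ whenever $F\subset F'$. A space is scattered if each of its non-empty subspaces has an isolated point. Then: 1. $X$ is separable and metrizable, while $Y$ is a Fréchet–Urysohn stratifiable $\aleph_0$-space; 2. the spaces $X$ and $Y$ are Ascoli; 3. the product $X\times Y$ is $2$-Ascoli but is not Ascoli; 4. there are closed countable scattered subspaces $X_0\subset X$ and $Y_0\subset Y$ whose product $X_0\times Y_0$ is not $2$-Ascoli. -/

import Mathlib

open Set TopologicalSpace

/-- A set `K` of continuous maps is evenly continuous if the evaluation map
`(f, x) ↦ f x` is continuous on `K × X`, where `K` carries the subspace topology of the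
compact-open topology. -/
def EvenlyContinuous {X Y : Type*} [TopologicalSpace X] [TopologicalSpace Y]
    (K : Set C(X, Y)) : Prop :=
  Continuous fun p : K × X => (p.1 : C(X, Y)) p.2

/-- `X` is `Y`-Ascoli if each compact subset of `C(X, Y)`, with the compact-open topology, is
evenly continuous. -/
def IsYAscoli (X Y : Type*) [TopologicalSpace X] [TopologicalSpace Y] : Prop :=
  ∀ K : Set C(X, Y), IsCompact K → EvenlyContinuous K

/-- Ascoli spaces. -/
def IsAscoli (X : Type*) [TopologicalSpace X] : Prop := IsYAscoli X ℝ

/-- `2`-Ascoli spaces, where `2 = {0, 1}` is discrete. -/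
def IsTwoAscoli (X : Type*) [TopologicalSpace X] : Prop := IsYAscoli X (Fin 2)

/-- `N` is a `k`-network in `X`. -/
def IsKNetwork {X : Type*} [TopologicalSpace X] (N : Set (Set X)) : Prop :=
  ∀ U K : Set X, IsOpen U → IsCompact K → K ⊆ U →
    ∃ F : Set (Set X), F ⊆ N ∧ F.Finite ∧ K ⊆ ⋃₀ F ∧ ⋃₀ F ⊆ U

/-- An `ℵ₀`-space is a regular `T₁` space with a countable `k`-network. -/
def IsAlephZeroSpace (X : Type*) [TopologicalSpace X] : Prop :=
  T3Space X ∧ ∃ N : Set (Set X), N.Countable ∧ IsKNetwork N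

/-- Stratifiable spaces: regular `T₁` spaces with a function `G` which assigns to every `n` and
every closed set `F` an open neighborhood `G n F` of `F`, monotone in `F`, such that
`F` is the intersection of the closures of the sets `G n F`. -/
def IsStratifiable (X : Type*) [TopologicalSpace X] : Prop :=
  T3Space X ∧ ∃ G : ℕ → Closeds X → Opens X,
    (∀ n, ∀ F : Closeds X, (F : Set X) ⊆ (G n F : Set X)) ∧
    (∀ F : Closeds X, (F : Set X) = ⋂ n, closure (G n F : Set X)) ∧
    ∀ n, ∀ F F' : Closeds X, F ≤ F' → G n F ≤ G n F'

/-- A space is scattered if each non-empty subspace has an isolated point. -/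
def IsScatteredSpace (X : Type*) [TopologicalSpace X] : Prop :=
  ∀ S : Set X, S.Nonempty → ∃ x ∈ S, ∃ U : Set X, IsOpen U ∧ U ∩ S = {x}

/-- The arc `{(t, t / n) : t ∈ [0, 1]}` in the plane (used for `n > 0`). -/
def fanArc (n : ℕ) : Set (ℝ × ℝ) :=
  {p | ∃ t ∈ Icc (0 : ℝ) 1, p = (t, t / n)}

/-- The union of the arcs `fanArc n`, `n > 0`. -/
def fanSet : Set (ℝ × ℝ) := {p | ∃ n : ℕ, 0 < n ∧ p ∈ fanArc n}

/-- The connected metric fan: `fanSet` with the subspace topology of the plane. -/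
abbrev ConnectedMetricFan : Type := fanSet

/-- The underlying set of the connected Fréchet–Urysohn fan; its topology is given below. -/
def ConnectedFUFan : Type := fanSet

/-- The inclusion of the arc `fanArc n`, `n > 0`, into the underlying set of the fans. -/
def fanArcInclusion (n : ℕ) (hn : 0 < n) (p : fanArc n) : ConnectedFUFan :=
  ⟨p.1, n, hn, p.2⟩

/-- The strongest topology inducing the Euclidean topology on each arc `fanArc n`, `n > 0`: a set
is open if and only if its trace on each of these arcs is open. -/
instance instTopologicalSpaceConnectedFUFan : TopologicalSpace ConnectedFUFan :=
  ⨆ (n : ℕ) (hn : 0 < n), coinduced (fanArcInclusion n hn) inferInstance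

/-- The topology of `ConnectedFUFan` induces the Euclidean topology on each arc, and is the
strongest topology with this property (stronger topologies are smaller in the order used here). -/
theorem connectedFUFan_isLeast :
    IsLeast {τ : TopologicalSpace ConnectedFUFan |
      ∀ (n : ℕ) (hn : 0 < n), induced (fanArcInclusion n hn) τ = instTopologicalSpaceSubtype}
      inferInstance := by
  constructor
  · intro n hn
    apply le_antisymm
    · let e : ConnectedFUFan → ℝ × ℝ := fun q => q.1
      have he : @Continuous _ _ (inferInstance : TopologicalSpace ConnectedFUFan) _ e := by
        rw [continuous_iff_coinduced_le]
        simp only [inferInstance, instTopologicalSpaceConnectedFUFan, coinduced_iSup,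
          iSup_le_iff, coinduced_compose]
        intro m hm
        exact continuous_iff_coinduced_le.1 continuous_subtype_val
      have h1 := induced_mono (g := fanArcInclusion n hn) (continuous_iff_le_induced.1 he)
      rw [induced_compose] at h1
      exact h1
    · rw [← coinduced_le_iff_le_induced]
      exact le_iSup₂ (f := fun (n : ℕ) (hn : 0 < n) =>
        coinduced (fanArcInclusion n hn) inferInstance) n hn
  · intro τ hτ
    refine iSup₂_le fun n hn => ?_
    rw [coinduced_le_iff_le_induced, hτ n hn]

open Filter Topology unitInterval

/-! ### Ascoli spaces -/

/-! Both fans are Fréchet–Urysohn and Hausdorff, so their topology is determined by compact sets,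
which forces evaluation on compact families of maps to be jointly continuous. The product is
connected, so its maps to `Fin 2` are constant.

Non-Ascoliness comes from a double family. For a pair `(N, K)`, take a bump around the point with
parameter `1 / K` on arm `N` of the metric fan and `1 / N` on arm `K` of the other fan. A compact
set projects into finitely many arms `K` of the Fréchet–Urysohn fan
(`IsCompact.finite_setOf_armCoord_pos`). For each such `K`, the parts of the metric arms with
parameter at least `1 / (K + 1)` are locally finite, so only finitely many `N` matter. Hence the
bumps tend to `0` in the compact-open topology. Yet their peaks accumulate at the vertex: choose `K`
large for the metric factor, then `N` large depending on `K`. This contradicts even continuity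
(`not_isYAscoli_of_family`).

On the closed subspaces of points with parameters `0` and `1 / n` the peaks are isolated, so their
indicators replace the bumps and take values in `Fin 2`. -/

theorem isYAscoli_of_compactlyCoherent (X T : Type*) [TopologicalSpace X] [TopologicalSpace T]
    [T2Space X] [T2Space T] [CompactlyCoherentSpace X] : IsYAscoli X T := by
  intro K hK
  have : CompactSpace K := isCompact_iff_compactSpace.1 hK
  let φ : X → C(K, T) := fun x =>
    ⟨fun f => (f : C(X, T)) x, (continuous_eval_const x).comp continuous_subtype_val⟩
  have hφ : Continuous φ := by
    rw [CompactlyCoherentSpace.isCoherentWith.continuous_iff]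
    intro L hL
    have : CompactSpace L := isCompact_iff_compactSpace.1 hL
    rw [continuousOn_iff_continuous_domRestrict]
    -- Restriction to `L` is continuous into `C(L, T)`, and evaluation there is jointly continuous
    -- because `L` is compact. Compactness of `K` plays the same role for `φ` at the end.
    refine ContinuousMap.continuous_of_continuous_uncurry _ ?_
    have h1 : Continuous fun p : L × K => (p.2 : C(X, T)).restrict L :=
      (ContinuousMap.continuous_restrict L).comp (continuous_subtype_val.comp continuous_snd)
    exact h1.eval continuous_fst
  exact (hφ.comp continuous_snd).eval continuous_fst

/-- A family of maps which agree with `g` on each compact set up to finitely many exceptions, but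
whose values leave a neighborhood of `g z` arbitrarily close to `z`, refutes the Ascoli property. -/
theorem not_isYAscoli_of_family {Z T ι : Type*} [TopologicalSpace Z] [TopologicalSpace T]
    (f : ι → C(Z, T)) (g : C(Z, T)) (z : Z) (W : Set T) (hW : W ∈ 𝓝 (g z))
    (hfg : ∀ C : Set Z, IsCompact C → ∀ᶠ i in cofinite, EqOn (f i) g C)
    (hz : ∀ V ∈ 𝓝 z, {i | ∃ p ∈ V, f i p ∉ W}.Infinite) : ¬ IsYAscoli Z T := by
  intro hA
  have hlim : Tendsto f cofinite (𝓝 g) := by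
    rw [ContinuousMap.tendsto_nhds_compactOpen]
    intro C hC U _ hU
    filter_upwards [hfg C hC] with i hi x hx
    rw [hi hx]
    exact hU hx
  -- The family together with its limit is compact, so even continuity at `(g, z)` would keep almost
  -- all `f i` inside `W` on one neighborhood of `z`.
  have hc := hA _ hlim.isCompact_insert_range_of_cofinite
  have h1 := hc.continuousAt (x := (⟨g, mem_insert _ _⟩, z)) |>.preimage_mem_nhds hW
  rw [nhds_prod_eq] at h1
  obtain ⟨A, hA1, V, hV, hAV⟩ := Filter.mem_prod_iff.1 h1
  rw [nhds_subtype_eq_comap] at hA1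
  obtain ⟨B, hB, hBA⟩ := hA1
  have h2 : {i | ∃ p ∈ V, f i p ∉ W} ⊆ {i | ¬ f i ∈ B} := by
    rintro i ⟨p, hp, hpW⟩ hi
    exact hpW (hAV (mk_mem_prod
      (hBA (show (⟨f i, mem_insert_of_mem _ (mem_range_self i)⟩ : ↥(insert g (range f))) ∈ _
        from hi)) hp))
  exact hz V hV ((hlim hB : ∀ᶠ i in cofinite, f i ∈ B).subset h2)

theorem isTwoAscoli_of_preconnectedSpace (Z : Type*) [TopologicalSpace Z] [PreconnectedSpace Z] :
    IsTwoAscoli Z := by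
  intro K _
  rcases isEmpty_or_nonempty Z with hZ | ⟨⟨z⟩⟩
  · have : IsEmpty (K × Z) := inferInstance
    exact continuous_of_const fun x => isEmptyElim x
  · have h : (fun p : K × Z => (p.1 : C(Z, Fin 2)) p.2) = fun p => (p.1 : C(Z, Fin 2)) z := by
      funext p
      exact PreconnectedSpace.constant ‹_› (p.1 : C(Z, Fin 2)).continuous
    unfold EvenlyContinuous
    rw [h]
    exact (continuous_eval_const z).comp (continuous_subtype_val.comp continuous_fst)

/-! ### Coordinates on the fans -/

/-- The point with parameter `t` on the arc with number `N`. -/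
noncomputable def fanPoint (N : ℕ+) (t : I) : ConnectedFUFan :=
  ⟨((t : ℝ), (t : ℝ) / (N : ℕ)), N, N.pos, t, t.2, rfl⟩

/-- The identity map between the two fans. -/
def fanId (y : ConnectedFUFan) : ConnectedMetricFan := ⟨y.1, y.2⟩

theorem exists_fanPoint (y : ConnectedFUFan) : ∃ N t, fanPoint N t = y := by
  obtain ⟨p, n, hn, t, ht, rfl⟩ := y
  exact ⟨⟨n, hn⟩, ⟨t, ht⟩, rfl⟩

theorem fanId_bijective : Function.Bijective fanId := by
  refine ⟨fun x y h => ?_, fun x => ⟨⟨x.1, x.2⟩, rfl⟩⟩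
  exact Subtype.ext (congrArg (fun z : ConnectedMetricFan => z.1) h)

theorem fanPoint_eq_iff {M N : ℕ+} {s t : I} :
    fanPoint M s = fanPoint N t ↔ s = t ∧ (t = 0 ∨ M = N) := by
  constructor
  · intro h
    have h1 : (((s : ℝ), (s : ℝ) / (M : ℕ)) : ℝ × ℝ) = ((t : ℝ), (t : ℝ) / (N : ℕ)) :=
      congrArg (fun y : ConnectedFUFan => y.1) h
    obtain ⟨h2, h3⟩ := Prod.mk.inj h1
    have hst : s = t := Subtype.ext h2
    refine ⟨hst, or_iff_not_imp_left.2 fun ht => ?_⟩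
    have ht' : (t : ℝ) ≠ 0 := fun h => ht (Subtype.ext h)
    have hM : ((M : ℕ) : ℝ) ≠ 0 := by exact_mod_cast M.pos.ne'
    have hN : ((N : ℕ) : ℝ) ≠ 0 := by exact_mod_cast N.pos.ne'
    rw [h2] at h3
    field_simp at h3
    exact PNat.coe_injective (by exact_mod_cast h3.symm)
  · rintro ⟨rfl, rfl | rfl⟩
    · exact Subtype.ext (by simp [fanPoint])
    · rfl

theorem fanPoint_zero (M N : ℕ+) : fanPoint M 0 = fanPoint N 0 := fanPoint_eq_iff.2 ⟨rfl, .inl rfl⟩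

theorem isOpen_connectedFUFan_iff {U : Set ConnectedFUFan} :
    IsOpen U ↔ ∀ N, IsOpen (fanPoint N ⁻¹' U) := by
  have key : IsOpen U ↔ ∀ (n : ℕ) (hn : 0 < n), IsOpen (fanArcInclusion n hn ⁻¹' U) := by
    simp only [isOpen_iSup_iff, isOpen_coinduced]
  rw [key]
  constructor
  · intro h N
    have hc : Continuous fun t : I => (⟨((t : ℝ), (t : ℝ) / (N : ℕ)), t, t.2, rfl⟩ : fanArc N) := by
      fun_prop
    exact (h N N.pos).preimage hc
  · intro h n hn
    have hc : Continuous fun p : fanArc n => (⟨p.1.1, by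
        obtain ⟨p, t, ht, rfl⟩ := p; exact ht⟩ : I) := by fun_prop
    convert (h ⟨n, hn⟩).preimage hc using 1
    ext ⟨p, t, ht, rfl⟩
    rfl

theorem isClosed_connectedFUFan_iff {U : Set ConnectedFUFan} :
    IsClosed U ↔ ∀ N, IsClosed (fanPoint N ⁻¹' U) := by
  simp only [← isOpen_compl_iff, isOpen_connectedFUFan_iff, preimage_compl]

theorem continuous_fanPoint (N : ℕ+) : Continuous (fanPoint N) :=
  continuous_def.2 fun _ hU => isOpen_connectedFUFan_iff.1 hU N

theorem continuous_fanId : Continuous fanId := by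
  refine continuous_def.2 fun U hU => isOpen_connectedFUFan_iff.2 fun N => ?_
  have : Continuous fun t : I => fanId (fanPoint N t) := by
    unfold fanId fanPoint
    fun_prop
  exact hU.preimage this

/-- The function on the plane which is `t` at the point with parameter `t` of the arc with number
`N`, and vanishes on the other arcs. -/
noncomputable def armCoord (N : ℕ+) (p : ℝ × ℝ) : ℝ :=
  max 0 (p.1 - ((N : ℕ) + 1) * |(N : ℕ) * p.2 - p.1|)

theorem continuous_armCoord (N : ℕ+) : Continuous (armCoord N) := by
  unfold armCoord
  fun_prop

theorem armCoord_nonneg (N : ℕ+) (p : ℝ × ℝ) : 0 ≤ armCoord N p := le_max_left _ _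

theorem armCoord_self (N : ℕ+) (t : I) : armCoord N (fanPoint N t).1 = t := by
  have hN : ((N : ℕ) : ℝ) ≠ 0 := by exact_mod_cast N.pos.ne'
  have : ((N : ℕ) : ℝ) * ((t : ℝ) / (N : ℕ)) - t = 0 := by field_simp; ring
  simp [armCoord, fanPoint, this, t.2.1]

/-- The slope `N + 1` in `armCoord` is what makes `(N + 1) * |N - M| ≥ M` for all `M ≠ N`, with
equality at `M = N + 1`. -/
theorem armCoord_of_ne {M N : ℕ+} (h : M ≠ N) (t : I) : armCoord N (fanPoint M t).1 = 0 := by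
  have hM : (0 : ℝ) < (M : ℕ) := by exact_mod_cast M.pos
  have hN : (0 : ℝ) < (N : ℕ) := by exact_mod_cast N.pos
  have hMN : (M : ℕ) ≠ N := fun h' => h (PNat.coe_injective h')
  have ht := t.2.1
  simp only [armCoord, fanPoint]
  refine max_eq_left (sub_nonpos.2 ?_)
  have h1 : ((N : ℕ) : ℝ) * ((t : ℝ) / (M : ℕ)) - t = (t : ℝ) * (((N : ℕ) - (M : ℕ)) / (M : ℕ)) := by
    field_simp
  rw [h1, abs_mul, abs_of_nonneg ht, abs_div, abs_of_pos hM]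
  have h2 : (1 : ℝ) ≤ ((N : ℕ) + 1) * (|((N : ℕ) : ℝ) - (M : ℕ)| / (M : ℕ)) := by
    rw [← mul_div_assoc, le_div_iff₀ hM, one_mul]
    rcases lt_or_gt_of_ne hMN with hlt | hgt
    · have : ((M : ℕ) : ℝ) + 1 ≤ (N : ℕ) := by exact_mod_cast hlt
      rw [abs_of_nonneg (by linarith)]
      nlinarith
    · have : ((N : ℕ) : ℝ) + 1 ≤ (M : ℕ) := by exact_mod_cast hgt
      rw [abs_of_nonpos (by linarith)]
      nlinarith
  nlinarith

theorem armCoord_pos_iff {N : ℕ+} {y : ConnectedFUFan} :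
    0 < armCoord N y.1 ↔ ∃ t : I, 0 < t ∧ fanPoint N t = y := by
  constructor
  · intro h
    obtain ⟨M, t, rfl⟩ := exists_fanPoint y
    obtain rfl : M = N := by
      by_contra hMN
      exact h.ne' (armCoord_of_ne hMN t)
    rw [armCoord_self] at h
    exact ⟨t, h, rfl⟩
  · rintro ⟨t, ht, rfl⟩
    rw [armCoord_self]
    exact ht

/-! ### The topology of the Fréchet–Urysohn fan -/

instance instT2SpaceConnectedFUFan : T2Space ConnectedFUFan :=
  T2Space.of_injective_continuous fanId_bijective.1 continuous_fanId

theorem continuous_connectedFUFan_val :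
    Continuous fun y : ConnectedFUFan => (y.1 : ℝ × ℝ) :=
  continuous_subtype_val.comp continuous_fanId

instance instFrechetUrysohnSpaceConnectedFUFan : FrechetUrysohnSpace ConnectedFUFan where
  closure_subset_seqClosure S := by
    let A : Set ConnectedFUFan := ⋃ N, fanPoint N '' closure (fanPoint N ⁻¹' S)
    have hA : IsClosed A := by
      refine isClosed_connectedFUFan_iff.2 fun M => ?_
      -- Distinct arcs meet only at the vertex, so the other arcs add at most the parameter `0`.
      have h1 : fanPoint M ⁻¹' A = closure (fanPoint M ⁻¹' S) ∪ {t | t = 0 ∧ t ∈ fanPoint M ⁻¹' A} := by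
        ext t
        simp only [A, mem_preimage, mem_iUnion, mem_union, mem_ofPred_eq, mem_image]
        constructor
        · rintro ⟨N, s, hs, h⟩
          obtain ⟨rfl, h0 | rfl⟩ := fanPoint_eq_iff.1 h
          · exact .inr ⟨h0, N, s, hs, h⟩
          · exact .inl hs
        · rintro (h | h)
          · exact ⟨M, t, h, rfl⟩
          · exact h.2
      rw [h1]
      exact isClosed_closure.union
        ((subsingleton_singleton.anti fun t ht => ht.1).finite.isClosed (s := {t | t = (0 : I) ∧ _}))
    have hSA : S ⊆ A := fun y hy => by
      obtain ⟨N, t, rfl⟩ := exists_fanPoint y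
      exact mem_iUnion.2 ⟨N, t, subset_closure hy, rfl⟩
    intro y hy
    obtain ⟨N, t, ht, rfl⟩ := mem_iUnion.1 (closure_minimal hSA hA hy)
    obtain ⟨x, hx, hxt⟩ := mem_closure_iff_seq_limit.1 ht
    exact ⟨fun n => fanPoint N (x n), hx, ((continuous_fanPoint N).tendsto t).comp hxt⟩

/-! ### Stratifiability -/

/-- The weight of the parameter `s` in the stratification of the Fréchet–Urysohn fan. -/
noncomputable def fanWeight (s : I) : ℝ := if s = 0 then 1 else s

theorem fanWeight_pos (s : I) : 0 < fanWeight s := by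
  unfold fanWeight
  split_ifs with h
  · exact one_pos
  · exact lt_of_le_of_ne s.2.1 fun h' => h (Subtype.ext h'.symm)

theorem fanWeight_le_one (s : I) : fanWeight s ≤ 1 := by
  unfold fanWeight
  split_ifs
  · exact le_rfl
  · exact s.2.2

/-- The neighborhoods of closed sets in a stratification of the Fréchet–Urysohn fan. -/
def fanNhd (k : ℕ) (F : Set ConnectedFUFan) : Set ConnectedFUFan :=
  {y | ∃ N s t, fanPoint N t = y ∧ fanPoint N s ∈ F ∧
    |(t : ℝ) - s| < 1 / ((k : ℝ) + 2) * fanWeight s}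

theorem fanPoint_mem_fanNhd {k : ℕ} {F : Set ConnectedFUFan} {M : ℕ+} {t : I} :
    fanPoint M t ∈ fanNhd k F ↔
      ∃ s, fanPoint M s ∈ F ∧ |(t : ℝ) - s| < 1 / ((k : ℝ) + 2) * fanWeight s := by
  constructor
  · rintro ⟨N, s, t', h, hs, hst⟩
    obtain ⟨rfl, rfl | rfl⟩ := fanPoint_eq_iff.1 h
    -- The radius at `s ≠ 0` is at most `s / 2`, so a ball centred off the vertex never reaches it
    -- and cannot spill into other arms.
    · have hs0 : s = 0 := by
        by_contra h0
        have hpos := fanWeight_pos s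
        simp only [Icc.coe_zero, zero_sub, abs_neg, fanWeight, if_neg h0] at hst hpos
        rw [abs_of_pos hpos] at hst
        have : 1 / ((k : ℝ) + 2) ≤ 1 := by
          rw [div_le_one (by positivity)]
          linarith [(Nat.cast_nonneg k : (0 : ℝ) ≤ k)]
        nlinarith
      subst hs0
      exact ⟨0, by rwa [fanPoint_zero M N], hst⟩
    · exact ⟨s, hs, hst⟩
  · rintro ⟨s, hs, hst⟩
    exact ⟨M, s, t, rfl, hs, hst⟩

theorem isOpen_fanNhd (k : ℕ) (F : Set ConnectedFUFan) : IsOpen (fanNhd k F) := by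
  refine isOpen_connectedFUFan_iff.2 fun M => ?_
  have : fanPoint M ⁻¹' fanNhd k F =
      ⋃ s ∈ fanPoint M ⁻¹' F, {t : I | |(t : ℝ) - s| < 1 / ((k : ℝ) + 2) * fanWeight s} := by
    ext t
    simp only [mem_preimage, fanPoint_mem_fanNhd, mem_iUnion, mem_ofPred_eq, exists_prop]
  rw [this]
  exact isOpen_biUnion fun s _ => isOpen_lt (by fun_prop) continuous_const

theorem subset_fanNhd (k : ℕ) (F : Set ConnectedFUFan) : F ⊆ fanNhd k F := by
  intro y hy
  obtain ⟨N, t, rfl⟩ := exists_fanPoint y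
  refine ⟨N, t, t, rfl, hy, ?_⟩
  rw [sub_self, abs_zero]
  exact mul_pos (by positivity) (fanWeight_pos t)

theorem fanNhd_mono (k : ℕ) {F F' : Set ConnectedFUFan} (h : F ⊆ F') : fanNhd k F ⊆ fanNhd k F' := by
  rintro y ⟨N, s, t, hy, hs, hst⟩
  exact ⟨N, s, t, hy, h hs, hst⟩

/-- This separation yields both regularity and stratifiability. At the vertex the gap to `F` may
shrink from arm to arm, which is why the radii in `fanNhd` are proportional to the parameter. -/
theorem exists_notMem_closure_fanNhd {F : Set ConnectedFUFan} (hF : IsClosed F)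
    {y : ConnectedFUFan} (hy : y ∉ F) : ∃ k, y ∉ closure (fanNhd k F) := by
  have hd : ∀ (N : ℕ+) (t : I), fanPoint N t ∉ F →
      ∃ δ > (0 : ℝ), ∀ s : I, |(t : ℝ) - s| < δ → fanPoint N s ∉ F := by
    intro N t ht
    have h1 : (fanPoint N ⁻¹' F)ᶜ ∈ 𝓝 t :=
      (hF.preimage (continuous_fanPoint N)).isOpen_compl.mem_nhds ht
    obtain ⟨δ, hδ, h⟩ := Metric.mem_nhds_iff.1 h1
    refine ⟨δ, hδ, fun s hs => h ?_⟩
    rw [Metric.mem_ball, dist_comm]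
    exact hs
  suffices h : ∃ k, ∃ V, IsOpen V ∧ y ∈ V ∧ Disjoint V (fanNhd k F) by
    obtain ⟨k, V, hV, hyV, hd⟩ := h
    exact ⟨k, fun hc => disjoint_left.1 (hd.closure_right hV) hyV hc⟩
  obtain ⟨N, t, rfl⟩ := exists_fanPoint y
  by_cases ht : t = 0
  · subst ht
    choose δ hδ hδF using fun M => hd M 0 (by rwa [fanPoint_zero M N])
    -- Points of `F` on arm `M` have `s ≥ δ M`, so their balls stay above `s / 2 ≥ δ M / 2`; thus `k
    -- = 0` already works.
    refine ⟨0, {y | ∃ M t, fanPoint M t = y ∧ (t : ℝ) < δ M / 2}, ?_, ⟨N, 0, rfl, ?_⟩, ?_⟩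
    · refine isOpen_connectedFUFan_iff.2 fun M => ?_
      have : fanPoint M ⁻¹' {y | ∃ M t, fanPoint M t = y ∧ (t : ℝ) < δ M / 2} =
          {t : I | (t : ℝ) < δ M / 2} := by
        ext t
        constructor
        · rintro ⟨M', t', h, h'⟩
          obtain ⟨rfl, rfl | rfl⟩ := fanPoint_eq_iff.1 h
          · exact half_pos (hδ M)
          · exact h'
        · exact fun h => ⟨M, t, rfl, h⟩
      rw [this]
      exact isOpen_lt continuous_subtype_val continuous_const
    · exact half_pos (hδ N)
    · refine disjoint_left.2 ?_
      rintro y ⟨M, t, rfl, ht⟩ h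
      obtain ⟨s, hs, hst⟩ := fanPoint_mem_fanNhd.1 h
      have hs0 : s ≠ 0 := by
        rintro rfl
        exact hδF M 0 (by simpa using hδ M) hs
      rw [fanWeight, if_neg hs0] at hst
      have h1 : δ M ≤ s := by
        by_contra! h1
        refine hδF M s ?_ hs
        rw [Icc.coe_zero, zero_sub, abs_neg, abs_of_nonneg s.2.1]
        exact h1
      have h2 := (abs_lt.1 hst).1
      norm_num at h2
      linarith
  · have htpos : 0 < (t : ℝ) := lt_of_le_of_ne t.2.1 fun h' => ht (Subtype.ext h'.symm)
    obtain ⟨δ, hδ, hδF⟩ := hd N t hy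
    obtain ⟨k, hk⟩ := exists_nat_one_div_lt (half_pos hδ)
    refine ⟨k, {y | 0 < armCoord N y.1 ∧ |y.1.1 - t| < δ / 2}, ?_, ⟨?_, ?_⟩, ?_⟩
    · have := continuous_connectedFUFan_val
      have h1 := (continuous_armCoord N).comp this
      exact (isOpen_lt continuous_const h1).inter
        (isOpen_lt ((continuous_fst.comp this).sub continuous_const).abs continuous_const)
    · rwa [armCoord_self]
    · simpa [fanPoint] using hδ
    · refine disjoint_left.2 ?_
      rintro y ⟨hy, hyt⟩ h
      obtain ⟨t', -, rfl⟩ := armCoord_pos_iff.1 hy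
      obtain ⟨s, hs, hst⟩ := fanPoint_mem_fanNhd.1 h
      refine hδF s ?_ hs
      have hyt' : |(t' : ℝ) - t| < δ / 2 := hyt
      have h1 : 1 / ((k : ℝ) + 2) * fanWeight s ≤ 1 / ((k : ℝ) + 1) := by
        refine (mul_le_of_le_one_right (by positivity) (fanWeight_le_one s)).trans ?_
        gcongr
        norm_num
      rw [abs_sub_comm] at hyt'
      calc |(t : ℝ) - s| ≤ |(t : ℝ) - t'| + |(t' : ℝ) - s| := abs_sub_le _ _ _
        _ < δ := by linarith

instance instT3SpaceConnectedFUFan : T3Space ConnectedFUFan where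
  regular := by
    intro F y hF hy
    obtain ⟨k, hk⟩ := exists_notMem_closure_fanNhd hF hy
    rw [Filter.disjoint_iff]
    exact ⟨fanNhd k F, (isOpen_fanNhd k F).mem_nhdsSet.2 (subset_fanNhd k F),
      (closure (fanNhd k F))ᶜ, isClosed_closure.isOpen_compl.mem_nhds hk,
      disjoint_left.2 fun z hz hz' => hz' (subset_closure hz)⟩

theorem isStratifiable_connectedFUFan : IsStratifiable ConnectedFUFan := by
  refine ⟨inferInstance, fun k F => ⟨fanNhd k F, isOpen_fanNhd k F⟩,
    fun k F => subset_fanNhd k F, fun F => ?_, fun k F F' h => fanNhd_mono k h⟩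
  refine (subset_iInter fun k => (subset_fanNhd k F).trans subset_closure).antisymm fun y hy => ?_
  by_contra h
  obtain ⟨k, hk⟩ := exists_notMem_closure_fanNhd F.isClosed h
  exact hk (mem_iInter.1 hy k)

/-! ### Compact subsets -/

theorem IsCompact.finite_setOf_armCoord_pos {K : Set ConnectedFUFan} (hK : IsCompact K) :
    {N : ℕ+ | ∃ y ∈ K, 0 < armCoord N y.1}.Finite := by
  have h : ∀ N ∈ {N : ℕ+ | ∃ y ∈ K, 0 < armCoord N y.1},
      ∃ t : I, 0 < t ∧ fanPoint N t ∈ K := by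
    rintro N ⟨y, hy, hN⟩
    obtain ⟨t, ht, rfl⟩ := armCoord_pos_iff.1 hN
    exact ⟨t, ht, hy⟩
  choose! t ht htK using h
  set A := {N : ℕ+ | ∃ y ∈ K, 0 < armCoord N y.1}
  by_contra hA
  have hinj : InjOn (fun N => fanPoint N (t N)) A := fun M _ N hN h =>
    (fanPoint_eq_iff.1 h).2.resolve_left (ht N hN).ne'
  obtain ⟨x, -, hx⟩ := ((infinite_image_iff hinj).2 hA).exists_accPt_of_subset_isCompact hK
    (image_subset_iff.2 htK)
  rw [accPt_principal_iff_clusterPt, ← mem_closure_iff_clusterPt] at hx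
  -- Every set of these chosen points has at most one point on each arc, hence is closed; an
  -- infinite one cannot accumulate in a compact set.
  have hcl : IsClosed ((fun N => fanPoint N (t N)) '' A \ {x}) := by
    refine isClosed_connectedFUFan_iff.2 fun M => Set.Finite.isClosed ?_
    refine (finite_singleton (t M)).subset ?_
    rintro s ⟨⟨N, hN, h⟩, -⟩
    obtain ⟨h1, h2 | rfl⟩ := fanPoint_eq_iff.1 h
    · exact ((ht N hN).ne' (h1.trans h2)).elim
    · exact h1.symm
  rw [hcl.closure_eq] at hx
  exact hx.2 rfl

theorem isAlephZeroSpace_connectedFUFan : IsAlephZeroSpace ConnectedFUFan := by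
  refine ⟨inferInstance, ⋃ N, (fanPoint N '' ·) '' countableBasis I,
    countable_iUnion fun N => (countable_countableBasis I).image _, ?_⟩
  intro U K hU hK hKU
  set A := {N : ℕ+ | ∃ y ∈ K, 0 < armCoord N y.1}
  -- Arm `1` is added to carry the vertex, where every `armCoord` vanishes.
  have hAf : (insert 1 A).Finite := hK.finite_setOf_armCoord_pos.insert 1
  have hKA : ∀ y ∈ K, ∃ N ∈ insert 1 A, ∃ t, fanPoint N t = y := by
    intro y hy
    obtain ⟨N, t, rfl⟩ := exists_fanPoint y
    by_cases ht : t = 0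
    · exact ⟨1, mem_insert _ _, 0, fanPoint_eq_iff.2 ⟨ht.symm, .inl ht⟩⟩
    · refine ⟨N, mem_insert_of_mem _ ⟨_, hy, ?_⟩, t, rfl⟩
      exact armCoord_pos_iff.2 ⟨t, unitInterval.pos_iff_ne_zero.2 ht, rfl⟩
  have hbasis : ∀ N, ∃ F ⊆ countableBasis I, F.Finite ∧ fanPoint N ⁻¹' K ⊆ ⋃₀ F ∧
      ⋃₀ F ⊆ fanPoint N ⁻¹' U := by
    intro N
    have hKN : IsCompact (fanPoint N ⁻¹' K) :=
      (hK.isClosed.preimage (continuous_fanPoint N)).isCompact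
    have hUN := hU.preimage (continuous_fanPoint N)
    have := fun t (ht : t ∈ fanPoint N ⁻¹' K) =>
      (isBasis_countableBasis I).exists_subset_of_mem_open (hKU ht : t ∈ fanPoint N ⁻¹' U) hUN
    choose! B hB htB hBU using this
    obtain ⟨T, hT, hcov⟩ := hKN.elim_nhds_subcover B fun t ht =>
      ((isBasis_countableBasis I).isOpen (hB t ht)).mem_nhds (htB t ht)
    refine ⟨B '' T, ?_, T.finite_toSet.image _, ?_, ?_⟩
    · rintro _ ⟨t, ht, rfl⟩
      exact hB t (hT t ht)
    · rwa [sUnion_image]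
    · rw [sUnion_image]
      exact iUnion₂_subset fun t ht => hBU t (hT t ht)
  choose F hFB hFf hKF hFU using hbasis
  refine ⟨⋃ N ∈ insert 1 A, (fanPoint N '' ·) '' F N, ?_, ?_, ?_, ?_⟩
  · exact iUnion₂_subset fun N _ => (image_mono (hFB N)).trans
      (subset_iUnion (fun N => (fanPoint N '' ·) '' countableBasis I) N)
  · exact hAf.biUnion fun N _ => (hFf N).image _
  · intro y hy
    obtain ⟨N, hN, t, rfl⟩ := hKA y hy
    obtain ⟨B, hB, htB⟩ := hKF N hy
    exact ⟨fanPoint N '' B, mem_biUnion hN (mem_image_of_mem _ hB), mem_image_of_mem _ htB⟩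
  · rintro y ⟨_, hB, hy⟩
    obtain ⟨N, -, B, hBF, rfl⟩ := mem_iUnion₂.1 hB
    obtain ⟨t, ht, rfl⟩ := hy
    exact hFU N (mem_sUnion_of_mem ht hBF)

/-! ### Connectedness -/

instance instPreconnectedSpaceConnectedFUFan : PreconnectedSpace ConnectedFUFan where
  isPreconnected_univ := by
    have h : (univ : Set ConnectedFUFan) = ⋃ N, range (fanPoint N) := by
      refine (eq_univ_of_forall fun y => ?_).symm
      obtain ⟨N, t, rfl⟩ := exists_fanPoint y
      exact mem_iUnion.2 ⟨N, mem_range_self t⟩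
    rw [h]
    exact isPreconnected_iUnion ⟨fanPoint 1 0, mem_iInter.2 fun N => ⟨0, fanPoint_zero N 1⟩⟩
      fun N => isPreconnected_range (continuous_fanPoint N)

instance instPreconnectedSpaceConnectedMetricFan : PreconnectedSpace ConnectedMetricFan where
  isPreconnected_univ := by
    rw [← fanId_bijective.2.range_eq]
    exact isPreconnected_range continuous_fanId

/-! ### Compact subsets of the product of the fans -/

/-- Near the vertex all parameters are below `ε`; elsewhere the arm without its vertex is a
neighborhood missing the other arms. -/
theorem locallyFinite_le_armCoord {ε : ℝ} (hε : 0 < ε) :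
    LocallyFinite fun N : ℕ+ => {x : ConnectedMetricFan | ε ≤ armCoord N x.1} := by
  intro x
  obtain ⟨y, rfl⟩ := fanId_bijective.2 x
  obtain ⟨M, t, rfl⟩ := exists_fanPoint y
  by_cases ht : t = 0
  · subst ht
    refine ⟨{x | x.1.1 < ε}, IsOpen.mem_nhds (isOpen_lt (by fun_prop) continuous_const) hε, ?_⟩
    convert finite_empty
    refine eq_empty_of_forall_notMem ?_
    rintro N ⟨x, hx, hxε⟩
    obtain ⟨y, rfl⟩ := fanId_bijective.2 x
    obtain ⟨M', t, rfl⟩ := exists_fanPoint y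
    obtain ⟨s, -, hs⟩ := armCoord_pos_iff.1 (hε.trans_le hx)
    rw [← hs] at hx hxε
    exact (armCoord_self N s ▸ (show ε ≤ armCoord N (fanPoint N s).1 from hx)).not_gt hxε
  · refine ⟨{x | 0 < armCoord M x.1}, IsOpen.mem_nhds (isOpen_lt continuous_const
      ((continuous_armCoord M).comp continuous_subtype_val)) ?_, (finite_singleton M).subset ?_⟩
    · exact armCoord_pos_iff.2 ⟨t, unitInterval.pos_iff_ne_zero.2 ht, rfl⟩
    · rintro N ⟨x, hx, hxM⟩
      obtain ⟨y, rfl⟩ := fanId_bijective.2 x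
      obtain ⟨s, -, hs : fanPoint M s = y⟩ := armCoord_pos_iff.1 hxM
      subst hs
      by_contra hNM
      have : ε ≤ armCoord N (fanPoint M s).1 := hx
      rw [armCoord_of_ne (Ne.symm hNM)] at this
      exact this.not_gt hε

theorem IsCompact.finite_setOf_armCoord_prod {C : Set (ConnectedMetricFan × ConnectedFUFan)}
    (hC : IsCompact C) :
    {i : ℕ+ × ℕ+ | ∃ p ∈ C, 1 / ((i.2 : ℕ) + 1 : ℝ) ≤ armCoord i.1 p.1.1 ∧
      0 < armCoord i.2 p.2.1}.Finite := by
  have h2 := (hC.image continuous_snd).finite_setOf_armCoord_pos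
  have h1 := fun K : ℕ+ => (locallyFinite_le_armCoord (ε := 1 / ((K : ℕ) + 1 : ℝ))
    (by positivity)).finite_nonempty_inter_compact (hC.image continuous_fst)
  refine (h2.biUnion fun K _ => (h1 K).prod (finite_singleton K)).subset ?_
  rintro ⟨N, K⟩ ⟨p, hp, hN, hK⟩
  exact mem_biUnion (x := K) ⟨p.2, mem_image_of_mem _ hp, hK⟩
    ⟨⟨p.1, hN, mem_image_of_mem _ hp⟩, rfl⟩

/-- The parameter `1 / K`. -/
noncomputable def invParam (K : ℕ+) : I :=
  ⟨1 / (K : ℕ), by positivity, by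
    rw [div_le_one (by exact_mod_cast K.pos)]
    exact_mod_cast K.pos⟩

theorem tendsto_invParam : Tendsto (fun n : ℕ => invParam n.succPNat) atTop (𝓝 0) := by
  rw [tendsto_subtype_rng]
  simpa [invParam] using tendsto_one_div_add_atTop_nhds_zero_nat (𝕜 := ℝ)

/-- The point with parameter `1 / K` on the arc `N` of the metric fan, paired with the point with
parameter `1 / N` on the arc `K` of the Fréchet–Urysohn fan. -/
noncomputable def crossPoint (i : ℕ+ × ℕ+) : ConnectedMetricFan × ConnectedFUFan :=
  (fanId (fanPoint i.1 (invParam i.2)), fanPoint i.2 (invParam i.1))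

/-- The vertex of the product of the fans. -/
noncomputable def prodVertex : ConnectedMetricFan × ConnectedFUFan :=
  (fanId (fanPoint 1 0), fanPoint 1 0)

theorem infinite_setOf_crossPoint_mem {V : Set (ConnectedMetricFan × ConnectedFUFan)}
    (hV : V ∈ 𝓝 prodVertex) : {i | crossPoint i ∈ V}.Infinite := by
  rw [prodVertex, nhds_prod_eq] at hV
  obtain ⟨A, hA, B, hB, hAB⟩ := mem_prod_iff.1 hV
  obtain ⟨ε, hε, hεA⟩ := Metric.mem_nhds_iff.1 hA
  obtain ⟨k, hk⟩ := exists_nat_one_div_lt hε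
  set K := k.succPNat
  have hKε : ((invParam K : I) : ℝ) < ε := by simpa [invParam, K] using hk
  have hKA : ∀ N, fanId (fanPoint N (invParam K)) ∈ A := by
    intro N
    refine hεA ?_
    rw [Metric.mem_ball, Subtype.dist_eq]
    have h0 := (invParam K).2.1
    have hN : (1 : ℝ) ≤ (N : ℕ) := by exact_mod_cast N.pos
    simp only [fanId, fanPoint, Prod.dist_eq, Icc.coe_zero, zero_div, dist_zero_right,
      Real.norm_eq_abs, max_lt_iff]
    rw [abs_of_nonneg h0, abs_of_nonneg (by positivity)]
    exact ⟨hKε, (div_le_self h0 hN).trans_lt hKε⟩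
  have hB' : ∀ᶠ n : ℕ in atTop, fanPoint K (invParam n.succPNat) ∈ B := by
    rw [fanPoint_zero 1 K] at hB
    exact (((continuous_fanPoint K).tendsto 0).comp tendsto_invParam).eventually hB
  obtain ⟨m, hm⟩ := eventually_atTop.1 hB'
  refine infinite_of_injective_forall_mem (f := fun n : ℕ => ((n + m).succPNat, K)) ?_ ?_
  · intro a b h
    simpa using h
  · exact fun n => hAB ⟨hKA _, hm _ (Nat.le_add_left m n)⟩

theorem not_isAscoli_connectedMetricFan_prod_connectedFUFan :
    ¬ IsAscoli (ConnectedMetricFan × ConnectedFUFan) := by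
  have hc1 := fun N : ℕ+ => (continuous_armCoord N).comp
    (continuous_subtype_val.comp (continuous_fst (X := ConnectedMetricFan) (Y := ConnectedFUFan)))
  have hc2 := fun N : ℕ+ => (continuous_armCoord N).comp
    (continuous_connectedFUFan_val.comp
      (continuous_snd (X := ConnectedMetricFan) (Y := ConnectedFUFan)))
  -- The cutoff `1 / (K + 1)` lies just below `1 / K`. At the cross point the last two factors are
  -- `1 / K` and `1 / N`, so the factor `N * K` makes the value exactly `1`.
  let f : ℕ+ × ℕ+ → C(ConnectedMetricFan × ConnectedFUFan, ℝ) := fun i =>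
    ⟨fun p => (i.1 : ℕ) * (i.2 : ℕ) * max 0 (((i.2 : ℕ) + 1) * armCoord i.1 p.1.1 - 1) *
      armCoord i.2 p.2.1,
      (continuous_const.mul (continuous_const.max
        ((continuous_const.mul (hc1 i.1)).sub continuous_const))).mul (hc2 i.2)⟩
  refine not_isYAscoli_of_family f 0 prodVertex (Iio 1) (Iio_mem_nhds one_pos) ?_ ?_
  · intro C hC
    refine hC.finite_setOf_armCoord_prod.subset fun i hi => ?_
    by_contra hi'
    refine hi fun p hp => ?_
    have h : armCoord i.1 p.1.1 < 1 / ((i.2 : ℕ) + 1 : ℝ) ∨ armCoord i.2 p.2.1 = 0 := by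
      by_contra! h
      exact hi' ⟨p, hp, h.1, (armCoord_nonneg _ _).lt_of_ne' h.2⟩
    change (i.1 : ℕ) * (i.2 : ℕ) * max 0 (((i.2 : ℕ) + 1) * armCoord i.1 p.1.1 - 1) *
      armCoord i.2 p.2.1 = (0 : ℝ)
    rcases h with h | h
    · rw [lt_div_iff₀ (by positivity)] at h
      rw [max_eq_left (by linarith), mul_zero, zero_mul]
    · rw [h, mul_zero]
  · intro V hV
    refine (infinite_setOf_crossPoint_mem hV).mono fun i hi => ⟨crossPoint i, hi, ?_⟩
    have h1 : armCoord i.1 (crossPoint i).1.1 = 1 / (i.2 : ℕ) := armCoord_self _ _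
    have h2 : armCoord i.2 (crossPoint i).2.1 = 1 / (i.1 : ℕ) := armCoord_self _ _
    have hN : (0 : ℝ) < (i.1 : ℕ) := by exact_mod_cast i.1.pos
    have hK : (0 : ℝ) < (i.2 : ℕ) := by exact_mod_cast i.2.pos
    have h3 : f i (crossPoint i) = 1 := by
      change (i.1 : ℕ) * (i.2 : ℕ) * max 0 (((i.2 : ℕ) + 1) * armCoord i.1 (crossPoint i).1.1 - 1) *
        armCoord i.2 (crossPoint i).2.1 = (1 : ℝ)
      have h4 : (((i.2 : ℕ) : ℝ) + 1) * (1 / (i.2 : ℕ)) - 1 = 1 / (i.2 : ℕ) := by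
        field_simp
        ring
      rw [h1, h2, h4, max_eq_right (by positivity)]
      field_simp
    rw [h3]
    exact self_notMem_Iio

/-! ### Countable scattered subspaces -/

theorem isScatteredSpace_of_isOpen_singleton {Z : Type*} [TopologicalSpace Z] (z : Z)
    (h : ∀ x, x ≠ z → IsOpen {x}) : IsScatteredSpace Z := by
  intro S hS
  by_cases hx : ∃ x ∈ S, x ≠ z
  · obtain ⟨x, hxS, hxz⟩ := hx
    exact ⟨x, hxS, {x}, h x hxz, inter_eq_left.2 (singleton_subset_iff.2 hxS)⟩
  · push Not at hx
    have hSz : S = {z} := eq_singleton_iff_nonempty_unique_mem.2 ⟨hS, hx⟩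
    exact ⟨z, hSz ▸ rfl, univ, isOpen_univ, by rw [univ_inter, hSz]⟩

/-- The points of the metric fan with parameters `0` and `1 / n`. -/
def discreteMetricFan : Set ConnectedMetricFan :=
  {x | x.1.1 ∈ insert (0 : ℝ) (range fun n : ℕ => 1 / ((n : ℝ) + 1))}

/-- The points of the Fréchet–Urysohn fan with parameters `0` and `1 / n`. -/
def discreteFUFan : Set ConnectedFUFan := fanId ⁻¹' discreteMetricFan

theorem isClosed_discreteMetricFan : IsClosed discreteMetricFan :=
  tendsto_one_div_add_atTop_nhds_zero_nat.isCompact_insert_range.isClosed.preimage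
    (continuous_fst.comp continuous_subtype_val)

theorem isClosed_discreteFUFan : IsClosed discreteFUFan :=
  isClosed_discreteMetricFan.preimage continuous_fanId

theorem countable_discreteFUFan : discreteFUFan.Countable := by
  have h : (insert (0 : ℝ) (range fun n : ℕ => 1 / ((n : ℝ) + 1))).Countable :=
    (countable_range _).insert 0
  have h2 := h.preimage_of_injOn (f := ((↑) : I → ℝ)) Subtype.val_injective.injOn
  refine (countable_iUnion fun N => h2.image (fanPoint N)).mono fun y hy => ?_
  obtain ⟨N, t, rfl⟩ := exists_fanPoint y
  exact mem_iUnion.2 ⟨N, t, hy, rfl⟩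

theorem countable_discreteMetricFan : discreteMetricFan.Countable := by
  rw [← image_preimage_eq discreteMetricFan fanId_bijective.2]
  exact countable_discreteFUFan.image _

theorem isOpen_singleton_discreteMetricFan (x : discreteMetricFan)
    (hx : x.1 ≠ fanId (fanPoint 1 0)) : IsOpen {x} := by
  obtain ⟨x, hxD⟩ := x
  obtain ⟨y, rfl⟩ := fanId_bijective.2 x
  obtain ⟨N, t, rfl⟩ := exists_fanPoint y
  have ht : t ≠ 0 := by
    rintro rfl
    exact hx (congrArg fanId (fanPoint_zero N 1))
  have hxD' : (t : ℝ) ∈ insert (0 : ℝ) (range fun n : ℕ => 1 / ((n : ℝ) + 1)) := hxD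
  obtain ht0 | ⟨n, hn⟩ := hxD'
  · exact (ht (Subtype.ext ht0)).elim
  -- The inequalities say `1 / (n + 2) < x.1.1.1 < 1 / n`, cleared of denominators so that `n = 0`
  -- is covered.
  have h : ({⟨fanId (fanPoint N t), hxD⟩} : Set discreteMetricFan) =
      {x | 0 < armCoord N x.1.1} ∩ ({x | 1 < ((n : ℝ) + 2) * x.1.1.1} ∩ {x | (n : ℝ) * x.1.1.1 < 1}) := by
    ext ⟨x, hxD'⟩
    obtain ⟨y, rfl⟩ := fanId_bijective.2 x
    have hn' : (t : ℝ) = 1 / ((n : ℝ) + 1) := hn.symm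
    constructor
    · intro hxy
      obtain rfl : y = fanPoint N t := fanId_bijective.1 (congrArg Subtype.val hxy)
      refine ⟨armCoord_pos_iff.2 ⟨t, unitInterval.pos_iff_ne_zero.2 ht, rfl⟩, ?_, ?_⟩
      · change 1 < ((n : ℝ) + 2) * t
        rw [hn', mul_one_div, one_lt_div (by positivity)]
        linarith
      · change (n : ℝ) * t < 1
        rw [hn', mul_one_div, div_lt_one (by positivity)]
        linarith
    · rintro ⟨h1, h2, h3⟩
      obtain ⟨s, -, hs : fanPoint N s = y⟩ := armCoord_pos_iff.1 h1
      subst hs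
      replace h2 : 1 < ((n : ℝ) + 2) * s := h2
      replace h3 : (n : ℝ) * s < 1 := h3
      have hs : (s : ℝ) ∈ insert (0 : ℝ) (range fun n : ℕ => 1 / ((n : ℝ) + 1)) := hxD'
      obtain hs0 | ⟨m, hm⟩ := hs
      · rw [hs0] at h2
        norm_num at h2
      · rw [← hm] at h2 h3
        rw [mul_one_div, one_lt_div (by positivity)] at h2
        rw [mul_one_div, div_lt_one (by positivity)] at h3
        have h2' : m + 1 < n + 2 := by exact_mod_cast h2
        have h3' : n < m + 1 := by exact_mod_cast h3
        obtain rfl : m = n := by omega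
        obtain rfl : s = t := Subtype.ext (hm.symm.trans hn)
        rfl
  rw [h]
  refine (isOpen_lt continuous_const ?_).inter
    ((isOpen_lt continuous_const ?_).inter (isOpen_lt ?_ continuous_const))
  · exact (continuous_armCoord N).comp (continuous_subtype_val.comp continuous_subtype_val)
  · fun_prop
  · fun_prop

theorem isOpen_singleton_discreteFUFan (y : discreteFUFan) (hy : y.1 ≠ fanPoint 1 0) :
    IsOpen {y} := by
  let j : discreteFUFan → discreteMetricFan := fun y => ⟨fanId y.1, y.2⟩
  have hj : Continuous j := (continuous_fanId.comp continuous_subtype_val).subtype_mk _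
  have h := (isOpen_singleton_discreteMetricFan (j y) (fanId_bijective.1.ne hy)).preimage hj
  convert h
  ext z
  simp [j, Subtype.ext_iff, fanId_bijective.1.eq_iff]

theorem fanId_fanPoint_zero_mem : fanId (fanPoint 1 0) ∈ discreteMetricFan := mem_insert _ _

theorem isScatteredSpace_discreteMetricFan : IsScatteredSpace discreteMetricFan :=
  isScatteredSpace_of_isOpen_singleton ⟨fanId (fanPoint 1 0), fanId_fanPoint_zero_mem⟩
    fun x hx => isOpen_singleton_discreteMetricFan x fun h => hx (Subtype.ext h)

theorem isScatteredSpace_discreteFUFan : IsScatteredSpace discreteFUFan :=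
  isScatteredSpace_of_isOpen_singleton ⟨fanPoint 1 0, fanId_fanPoint_zero_mem⟩
    fun x hx => isOpen_singleton_discreteFUFan x fun h => hx (Subtype.ext h)

theorem fanId_fanPoint_invParam_mem (N K : ℕ+) :
    fanId (fanPoint N (invParam K)) ∈ discreteMetricFan := by
  refine mem_insert_of_mem _ ⟨K.natPred, ?_⟩
  have h : ((K.natPred : ℕ) : ℝ) + 1 = (K : ℕ) := by exact_mod_cast K.natPred_add_one
  simp only [h]
  rfl

theorem fanPoint_invParam_ne (N K : ℕ+) : fanPoint N (invParam K) ≠ fanPoint 1 0 := by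
  intro h
  have h1 := congrArg Subtype.val (fanPoint_eq_iff.1 h).1
  have hK : (0 : ℝ) < 1 / (K : ℕ) := one_div_pos.2 (by exact_mod_cast K.pos)
  exact hK.ne' h1

theorem not_isTwoAscoli_discreteMetricFan_prod_discreteFUFan :
    ¬ IsTwoAscoli (discreteMetricFan × discreteFUFan) := by
  let e : discreteMetricFan × discreteFUFan → ConnectedMetricFan × ConnectedFUFan :=
    Prod.map Subtype.val Subtype.val
  have he : IsEmbedding e := IsEmbedding.subtypeVal.prodMap IsEmbedding.subtypeVal
  let P : ℕ+ × ℕ+ → discreteMetricFan × discreteFUFan := fun i =>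
    (⟨fanId (fanPoint i.1 (invParam i.2)), fanId_fanPoint_invParam_mem _ _⟩,
      ⟨fanPoint i.2 (invParam i.1), fanId_fanPoint_invParam_mem _ _⟩)
  have hP : ∀ i, IsClopen {P i} := fun i => by
    refine ⟨isClosed_singleton, ?_⟩
    rw [← Prod.mk.eta (p := P i), ← singleton_prod_singleton]
    exact (isOpen_singleton_discreteMetricFan _ (fanId_bijective.1.ne (fanPoint_invParam_ne _ _))).prod
      (isOpen_singleton_discreteFUFan _ (fanPoint_invParam_ne _ _))
  classical
  let f : ℕ+ × ℕ+ → C(discreteMetricFan × discreteFUFan, Fin 2) := fun i =>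
    ⟨fun p => if p ∈ ({P i} : Set _) then 1 else 0, continuous_const.if
      (fun p hp => by simp [(hP i).frontier_eq] at hp) continuous_const⟩
  let z : discreteMetricFan × discreteFUFan :=
    (⟨fanId (fanPoint 1 0), fanId_fanPoint_zero_mem⟩, ⟨fanPoint 1 0, fanId_fanPoint_zero_mem⟩)
  refine not_isYAscoli_of_family f (ContinuousMap.const _ 0) z {0}
    ((isOpen_discrete _).mem_nhds rfl) ?_ ?_
  · intro C hC
    -- An indicator differs from `0` on `C` only if its cross point lies in `C`; finiteness is then
    -- inherited from the image of `C` in the full product.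
    refine (hC.image he.continuous).finite_setOf_armCoord_prod.subset fun i hi => ?_
    have hi' : P i ∈ C := by
      by_contra h
      exact hi fun p hp => if_neg fun h' : p = P i => h (h' ▸ hp)
    refine ⟨crossPoint i, ⟨P i, hi', rfl⟩, ?_, ?_⟩
    · have h1 : armCoord i.1 (crossPoint i).1.1 = 1 / (i.2 : ℕ) := armCoord_self _ _
      have hK : (0 : ℝ) < (i.2 : ℕ) := by exact_mod_cast i.2.pos
      rw [h1]
      gcongr
      linarith
    · have h2 : armCoord i.2 (crossPoint i).2.1 = 1 / (i.1 : ℕ) := armCoord_self _ _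
      rw [h2]
      exact one_div_pos.2 (by exact_mod_cast i.1.pos)
  · intro V hV
    rw [he.nhds_eq_comap] at hV
    obtain ⟨V', hV', hVV'⟩ := hV
    refine (infinite_setOf_crossPoint_mem hV').mono fun i hi => ⟨P i, hVV' hi, ?_⟩
    have : f i (P i) = 1 := if_pos rfl
    rw [this]
    simp

theorem propositionp :
    (SeparableSpace ConnectedMetricFan ∧ MetrizableSpace ConnectedMetricFan ∧
      FrechetUrysohnSpace ConnectedFUFan ∧ IsStratifiable ConnectedFUFan ∧
      IsAlephZeroSpace ConnectedFUFan) ∧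
    (IsAscoli ConnectedMetricFan ∧ IsAscoli ConnectedFUFan) ∧
    (IsTwoAscoli (ConnectedMetricFan × ConnectedFUFan) ∧
      ¬ IsAscoli (ConnectedMetricFan × ConnectedFUFan)) ∧
    (∃ (X₀ : Set ConnectedMetricFan) (Y₀ : Set ConnectedFUFan),
      (IsClosed X₀ ∧ X₀.Countable ∧ IsScatteredSpace X₀) ∧
      (IsClosed Y₀ ∧ Y₀.Countable ∧ IsScatteredSpace Y₀) ∧
      ¬ IsTwoAscoli (X₀ × Y₀)) :=
  ⟨⟨inferInstance, inferInstance, inferInstance, isStratifiable_connectedFUFan,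
      isAlephZeroSpace_connectedFUFan⟩,
    ⟨isYAscoli_of_compactlyCoherent _ _, isYAscoli_of_compactlyCoherent _ _⟩,
    ⟨isTwoAscoli_of_preconnectedSpace _, not_isAscoli_connectedMetricFan_prod_connectedFUFan⟩,
    discreteMetricFan, discreteFUFan,
    ⟨isClosed_discreteMetricFan, countable_discreteMetricFan, isScatteredSpace_discreteMetricFan⟩,
    ⟨isClosed_discreteFUFan, countable_discreteFUFan, isScatteredSpace_discreteFUFan⟩,
    not_isTwoAscoli_discreteMetricFan_prod_discreteFUFan⟩
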